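/- Let $\mathrm{SO}(3)$ be the group of real $3\times 3$ orthogonal matrices of determinant $1$ and let $\mu$ be its Haar probability measure. For an oriented axis generated by a unit vector $\mathbf n$ let $R(\mathbf n,t)=I+(\sin t)\,\hat{\mathbf n}+(1-\cos t)\,\hat{\mathbf n}^2$ be the rotation by the angle $t$ around it, where $\hat{\mathbf n}$ is the matrix of $x\mapsto \mathbf n\times x$. Let $U=[-\pi,\pi]\times[0,\pi]\times[-\pi,\pi]$ and let $p$ be the Euler-angle parametrisation, which sends $u=(\alpha,\beta,\gamma)$ to $$p(u)=\begin{pmatrix} \cos\alpha\cos\gamma-\cos\beta\sin\alpha\sin\gamma & -\cos\alpha\sin\gamma-\cos\beta\cos\gamma\sin\alpha & \sin\alpha\sin\beta\\ \cos\gamma\sin\alpha+\cos\alpha\cos\beta\sin\gamma & \cos\alpha\cos\beta\cos\gamma-\sin\alpha\sin\gamma & -\cos\alpha\sin\beta\\ \sin\beta\sin\gamma & \cos\gamma\sin\beta & \cos\beta\end{pmatrix}\in\mathrm{SO}(3).$$ Then $p(\alpha,\beta,\gamma)=R(e_Z,\alpha)\,R(e_X,\beta)\,R(e_Z,\gamma)$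 for all real $\alpha,\beta,\gamma$; $p(U)=\mathrm{SO}(3)$; the restriction of $p$ to the interior of $U$ is a homeomorphism onto an open subset of $\mathrm{SO}(3)$; and in this chart the Haar probability measure is $$(p^*\mu)_u=\frac{1}{8\pi^2}\,\sin\beta\;d\alpha\,d\beta\,d\gamma .$$ The last formula means all of the following. 1. For every Borel set $A\subseteq U$, $\mu(p(A))=\int_A \frac{1}{8\pi^2}\sin\beta\,d\alpha\,d\beta\,d\gamma$. 2. $\mu$ is the image under $p$ of the measure $\frac{1}{8\pi^2}\sin\beta\,d\alpha\,d\beta\,d\gamma$ on $U$. 3. Let $\theta^1,\theta^2,\theta^3$ be the components of the left Maurer-Cartan form $\theta(X)=g^{-1}X$ ($X$ tangent to $\mathrm{SO}(3)$ at $g$) in the basis $(\hat e_i)$ of $\mathfrak{so}(3)$, let $k_0(u)=\det\big(\theta^i_{p(u)}(\partial p/\partial u^j)\big)$, so that $p^*(\theta^1\wedge\theta^2\wedge\theta^3)=k_0\,d\alpha\wedge d\beta\wedge d\gamma$, and let $C=\int_U k_0$. Then $C^{-1}k_0(u)=\frac{1}{8\pi^2}\sin\beta$ for every $u\in U$. 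-/

import Mathlib

open MeasureTheory Set

/-- The rotation group `SO(3)`, with the topology of a subspace of the real `3 × 3` matrices. -/
abbrev SO3 : Type := Matrix.specialOrthogonalGroup (Fin 3) ℝ

/-- `SO(3)` carries its Borel σ-algebra. -/
instance instMeasurableSpaceSO3 : MeasurableSpace SO3 := borel SO3

instance instBorelSpaceSO3 : BorelSpace SO3 := ⟨rfl⟩

instance instIsTopologicalGroupSO3 : IsTopologicalGroup SO3 where
  continuous_mul := continuous_mul
  continuous_inv :=
    Continuous.subtype_mk (continuous_star.comp continuous_subtype_val) _

theorem SO3.abs_entry_le_one (g : SO3) (i j : Fin 3) : |(g : Matrix (Fin 3) (Fin 3) ℝ) i j| ≤ 1 := by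
  obtain ⟨A, hA⟩ := g
  have h := (Matrix.mem_specialOrthogonalGroup_iff (n := Fin 3) (R := ℝ)).1 hA
  have h1 := congrFun (congrFun ((Matrix.mem_orthogonalGroup_iff (Fin 3) ℝ).1 h.1) i) i
  simp only [Matrix.mul_apply, Matrix.transpose_apply, Matrix.one_apply_eq] at h1
  have h2 : A i j * A i j ≤ ∑ k, A i k * A i k :=
    Finset.single_le_sum (f := fun k => A i k * A i k)
      (fun k _ => mul_self_nonneg _) (Finset.mem_univ j)
  rw [h1] at h2
  exact abs_le_one_iff_mul_self_le_one.2 h2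

instance instCompactSpaceSO3 : CompactSpace SO3 := by
  apply isCompact_iff_compactSpace.1
  have hK : IsCompact (Set.pi univ fun _ : Fin 3 => Set.pi univ fun _ : Fin 3 => Icc (-1 : ℝ) 1) :=
    isCompact_univ_pi fun _ => isCompact_univ_pi fun _ => isCompact_Icc
  have hc : IsClosed ((Matrix.specialOrthogonalGroup (Fin 3) ℝ : Set (Matrix (Fin 3) (Fin 3) ℝ))) := by
    have : (Matrix.specialOrthogonalGroup (Fin 3) ℝ : Set (Matrix (Fin 3) (Fin 3) ℝ)) =
        {A | A * A.transpose = 1} ∩ {A | A.det = 1} := by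
      ext A
      simp only [SetLike.mem_coe, Matrix.mem_specialOrthogonalGroup_iff,
        Matrix.mem_orthogonalGroup_iff, mem_inter_iff, mem_ofPred_eq]
    rw [this]
    exact (isClosed_eq (continuous_id.matrix_mul continuous_id.matrix_transpose)
      continuous_const).inter (isClosed_eq continuous_id.matrix_det continuous_const)
  exact IsCompact.of_isClosed_subset hK hc fun A hA i _ j _ =>
    abs_le.1 (SO3.abs_entry_le_one ⟨A, hA⟩ i j)

/-- The Haar probability measure of `SO(3)`: the left-invariant Borel measure giving the whole
group mass one. -/
noncomputable def haarSO3 : Measure SO3 := Measure.haarMeasure ⊤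

/-- The isomorphism of `ℝ³` with the skew-symmetric matrices: `hat n` is the matrix of
`x ↦ n × x`. -/
def hat (n : Fin 3 → ℝ) : Matrix (Fin 3) (Fin 3) ℝ :=
  !![0, -n 2, n 1; n 2, 0, -n 0; -n 1, n 0, 0]

/-- The rotation by the angle `t` around the oriented axis generated by the unit vector `n`
(the Olinde-Rodrigues formula). -/
noncomputable def axisRotation (n : Fin 3 → ℝ) (t : ℝ) : Matrix (Fin 3) (Fin 3) ℝ :=
  1 + Real.sin t • hat n + (1 - Real.cos t) • (hat n) ^ 2

/-- The matrix of the rotation with Euler angles `u = (α, β, γ)`. -/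
noncomputable def eulerMatrix (u : ℝ × ℝ × ℝ) : Matrix (Fin 3) (Fin 3) ℝ :=
  let α := u.1
  let β := u.2.1
  let γ := u.2.2
  !![Real.cos α * Real.cos γ - Real.cos β * Real.sin α * Real.sin γ,
      -Real.cos α * Real.sin γ - Real.cos β * Real.cos γ * Real.sin α,
      Real.sin α * Real.sin β;
    Real.cos γ * Real.sin α + Real.cos α * Real.cos β * Real.sin γ,
      Real.cos α * Real.cos β * Real.cos γ - Real.sin α * Real.sin γ,
      -Real.cos α * Real.sin β;
    Real.sin β * Real.sin γ, Real.cos γ * Real.sin β, Real.cos β]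

theorem eulerMatrix_mem (u : ℝ × ℝ × ℝ) :
    eulerMatrix u ∈ Matrix.specialOrthogonalGroup (Fin 3) ℝ := by
  obtain ⟨α, β, γ⟩ := u
  have ha := Real.sin_sq_add_cos_sq α
  have hb := Real.sin_sq_add_cos_sq β
  have hc := Real.sin_sq_add_cos_sq γ
  rw [Matrix.mem_specialOrthogonalGroup_iff, Matrix.mem_orthogonalGroup_iff]
  constructor
  · ext i j
    fin_cases i <;> fin_cases j <;>
      simp [eulerMatrix, Matrix.mul_apply, Fin.sum_univ_three] <;> grind
  · simp only [eulerMatrix, Matrix.det_fin_three]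
    simp
    grind

/-- The Euler-angle parametrisation of `SO(3)`. -/
noncomputable def eulerChart (u : ℝ × ℝ × ℝ) : SO3 := ⟨eulerMatrix u, eulerMatrix_mem u⟩

/-- The domain `[-π, π] × [0, π] × [-π, π]` of the Euler angles. -/
def eulerDomain : Set (ℝ × ℝ × ℝ) :=
  Icc (-Real.pi) Real.pi ×ˢ Icc 0 Real.pi ×ˢ Icc (-Real.pi) Real.pi

/-- The components `θ¹, θ², θ³`, in the basis `(hat eᵢ)` of the Lie algebra `𝔰𝔬(3)`, of the left
Maurer-Cartan form `θ(X) = g⁻¹ X`, at a point `g` and a tangent vector `X` of `SO(3)` at `g`. This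
basis is orthonormal for the scalar product `⟨A, B⟩ = tr (A Bᵀ) / 2`. -/
noncomputable def maurerCartan (g : SO3) (X : Matrix (Fin 3) (Fin 3) ℝ) (i : Fin 3) : ℝ :=
  (((g⁻¹ : SO3) : Matrix (Fin 3) (Fin 3) ℝ) * X * (hat (Pi.single i 1)).transpose).trace / 2

/-- The partial derivatives, entry by entry, of the Euler matrix in `α`, `β`, `γ`. -/
noncomputable def eulerPartial (j : Fin 3) (u : ℝ × ℝ × ℝ) : Matrix (Fin 3) (Fin 3) ℝ :=
  Matrix.of fun a b =>
    lineDeriv ℝ (fun v => eulerMatrix v a b) u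
      ((![(1, 0, 0), (0, 1, 0), (0, 0, 1)] : Fin 3 → ℝ × ℝ × ℝ) j)

/-- The coefficient, with respect to `dα ∧ dβ ∧ dγ`, of the pullback by the Euler-angle chart of
the left-invariant volume form `θ¹ ∧ θ² ∧ θ³` of `SO(3)`. -/
noncomputable def eulerVolumeCoeff (u : ℝ × ℝ × ℝ) : ℝ :=
  (Matrix.of fun i j => maurerCartan (eulerChart u) (eulerPartial j u) i).det

open scoped ENNReal

/-! Uniqueness of the left-invariant probability measure makes the Haar measure `μ` invariant on
both sides. So `∫ f dμ` does not change when `f(g)` is replaced by its average over `R(e_Z, a) g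
R(e_Z, c)`. Such rotations only shift the outer Euler angles, so by periodicity this average is a
function of `β = arccos g₂₂` alone (`lintegral_zRotation_mul_mul`), and only the law of `g₂₂`
remains to be found.

That law is uniform on `[-1, 1]` (`lintegral_haarSO3_height`). By left invariance `⟨x/|x|, g e_Z⟩`
has the same law for every `x ≠ 0`. Average over `x` in the unit ball and exchange the integrals:
for fixed `g`, rotating `x` turns the quantity into `x₂/|x|`, whose law is computed in spherical
coordinates. With `t = cos β` this gives the factor `sin β`, and the constant is `2 · (2π)² = 8π²`.

The result is the image formula. The formula for `μ(p(A))` follows because `p` is injective on the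
interior of `U`, no boundary point shares a fibre with an interior one, and the boundary is null.
The statement on the volume form is an independent computation: `k₀ = -sin β`, and normalisation
removes the sign. -/

theorem eulerChart_apply_eq_axisRotation (α β γ : ℝ) :
    (eulerChart (α, β, γ) : Matrix (Fin 3) (Fin 3) ℝ) =
      axisRotation ![0, 0, 1] α * axisRotation ![1, 0, 0] β * axisRotation ![0, 0, 1] γ := by
  ext i j
  fin_cases i <;> fin_cases j <;>
    simp [eulerChart, eulerMatrix, axisRotation, hat, pow_two, Matrix.mul_apply,
      Fin.sum_univ_three, Matrix.one_apply] <;> ring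

/-- `eulerChart (a, 0, 0)` is the rotation by `a` about `Z`, and angles about a common axis add. The
double-coset average rests on this and on its right-hand counterpart. -/
theorem zRotation_mul_eulerChart (a α β γ : ℝ) :
    eulerChart (a, 0, 0) * eulerChart (α, β, γ) = eulerChart (a + α, β, γ) := by
  apply Subtype.ext
  ext i j
  fin_cases i <;> fin_cases j <;>
    simp [eulerChart, eulerMatrix, Real.sin_add, Real.cos_add] <;> ring

theorem eulerChart_mul_zRotation (c α β γ : ℝ) :
    eulerChart (α, β, γ) * eulerChart (c, 0, 0) = eulerChart (α, β, γ + c) := by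
  apply Subtype.ext
  ext i j
  fin_cases i <;> fin_cases j <;>
    simp [eulerChart, eulerMatrix, Real.sin_add, Real.cos_add] <;> ring

theorem continuous_eulerMatrix : Continuous eulerMatrix := by
  refine continuous_matrix fun i j => ?_
  fin_cases i <;> fin_cases j <;> simp [eulerMatrix] <;> fun_prop

theorem continuous_eulerChart : Continuous eulerChart :=
  continuous_eulerMatrix.subtype_mk _

theorem SO3.continuous_entry (i j : Fin 3) :
    Continuous fun g : SO3 => (g : Matrix (Fin 3) (Fin 3) ℝ) i j :=
  continuous_subtype_val.matrix_elem i j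

theorem SO3.mul_transpose (g : SO3) :
    (g : Matrix (Fin 3) (Fin 3) ℝ) * (g : Matrix (Fin 3) (Fin 3) ℝ).transpose = 1 :=
  (Matrix.mem_orthogonalGroup_iff (Fin 3) ℝ).1 (Matrix.mem_specialOrthogonalGroup_iff.1 g.2).1

theorem SO3.transpose_mul (g : SO3) :
    (g : Matrix (Fin 3) (Fin 3) ℝ).transpose * (g : Matrix (Fin 3) (Fin 3) ℝ) = 1 :=
  (Matrix.mem_orthogonalGroup_iff' (Fin 3) ℝ).1 (Matrix.mem_specialOrthogonalGroup_iff.1 g.2).1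

theorem SO3.det_eq_one (g : SO3) : (g : Matrix (Fin 3) (Fin 3) ℝ).det = 1 :=
  (Matrix.mem_specialOrthogonalGroup_iff.1 g.2).2

/-! ### Surjectivity of the Euler angles -/

/-- Polar coordinates in the plane, as an existence statement. -/
theorem exists_angle (x y : ℝ) : ∃ t ∈ Icc (-Real.pi) Real.pi,
    √(x ^ 2 + y ^ 2) * Real.cos t = x ∧ √(x ^ 2 + y ^ 2) * Real.sin t = y := by
  refine ⟨Complex.arg ⟨x, y⟩, ⟨(Complex.neg_pi_lt_arg _).le, Complex.arg_le_pi _⟩, ?_, ?_⟩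
  · simpa [Complex.norm_def, Complex.normSq_apply, pow_two] using
      Complex.norm_mul_cos_arg ⟨x, y⟩
  · simpa [Complex.norm_def, Complex.normSq_apply, pow_two] using
      Complex.norm_mul_sin_arg ⟨x, y⟩

/-- A rotation that fixes the third basis vector is a rotation around it. -/
theorem SO3.exists_eq_zRotation (g : SO3) (h : (g : Matrix (Fin 3) (Fin 3) ℝ) 2 2 = 1) :
    ∃ t ∈ Icc (-Real.pi) Real.pi, g = eulerChart (0, 0, t) := by
  have h1 := g.mul_transpose
  have h2 := g.transpose_mul
  have h3 := g.det_eq_one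
  rw [Matrix.det_fin_three] at h3
  generalize hM : (g : Matrix (Fin 3) (Fin 3) ℝ) = M at *
  have r := fun i j => congrFun (congrFun h1 i) j
  have c := fun i j => congrFun (congrFun h2 i) j
  simp only [Matrix.mul_apply, Matrix.transpose_apply, Fin.sum_univ_three] at r c
  have r22 := r 2 2
  have c22 := c 2 2
  have r00 := r 0 0
  have c00 := c 0 0
  have r01 := r 0 1
  have c01 := c 0 1
  have r11 := r 1 1
  simp [h] at r22 c22 r00 c00 r01 c01 r11
  -- The last row and the last column have norm one and already contain the entry 1, so `M` is block
  -- diagonal.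
  have e20 : M 2 0 = 0 := by nlinarith [sq_nonneg (M 2 0), sq_nonneg (M 2 1)]
  have e21 : M 2 1 = 0 := by nlinarith [sq_nonneg (M 2 0), sq_nonneg (M 2 1)]
  have e02 : M 0 2 = 0 := by nlinarith [sq_nonneg (M 0 2), sq_nonneg (M 1 2)]
  have e12 : M 1 2 = 0 := by nlinarith [sq_nonneg (M 0 2), sq_nonneg (M 1 2)]
  simp [e20, e21, e02, e12, h] at h3 r00 c00 r01 c01 r11
  obtain ⟨t, ht, hx, hy⟩ := exists_angle (M 0 0) (M 1 0)
  have hn : M 0 0 ^ 2 + M 1 0 ^ 2 = 1 := by linarith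
  rw [hn, Real.sqrt_one, one_mul] at hx hy
  have e11 : M 1 1 = M 0 0 := by grind
  have e01 : M 0 1 = - M 1 0 := by grind
  refine ⟨t, ht, Subtype.ext ?_⟩
  rw [hM]
  ext i j
  fin_cases i <;> fin_cases j <;>
    simp [eulerChart, eulerMatrix, *]

/-- Every unit vector is the third column of a rotation with Euler angles `(α, β, 0)`. -/
theorem exists_eulerChart_column (v : Fin 3 → ℝ) (hv : v 0 ^ 2 + v 1 ^ 2 + v 2 ^ 2 = 1) :
    ∃ α ∈ Icc (-Real.pi) Real.pi, ∃ β ∈ Icc 0 Real.pi,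
      ∀ i, (eulerChart (α, β, 0) : Matrix (Fin 3) (Fin 3) ℝ) i 2 = v i := by
  set β := Real.arccos (v 2) with hβ
  have hcos : Real.cos β = v 2 := Real.cos_arccos (by nlinarith) (by nlinarith)
  -- The third column of the chart is `(sin α sin β, -cos α sin β, cos β)`, hence the order and the
  -- sign of the two coordinates.
  obtain ⟨α, hα, hx, hy⟩ := exists_angle (-v 1) (v 0)
  have hsin : √((-v 1) ^ 2 + v 0 ^ 2) = Real.sin β := by
    rw [hβ, Real.sin_arccos]
    congr 1
    linarith
  rw [hsin] at hx hy
  refine ⟨α, hα, β, ⟨Real.arccos_nonneg _, Real.arccos_le_pi _⟩, fun i => ?_⟩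
  fin_cases i <;> simp [eulerChart, eulerMatrix] <;> linarith

/-- Choose `α, β` so that `p(α, β, 0)` has the third column of `g`; then `p(α, β, 0)⁻¹ g` fixes
`e_Z` and supplies `γ`. -/
theorem eulerChart_image_eulerDomain : eulerChart '' eulerDomain = univ := by
  refine eq_univ_of_forall fun g => ?_
  have h2 := congrFun (congrFun g.transpose_mul 2) 2
  simp only [Matrix.mul_apply, Matrix.transpose_apply, Fin.sum_univ_three,
    Matrix.one_apply_eq] at h2
  obtain ⟨α, hα, β, hβ, h⟩ := exists_eulerChart_column
    (fun i => (g : Matrix (Fin 3) (Fin 3) ℝ) i 2) (by linarith)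
  obtain ⟨γ, hγ, hg⟩ := SO3.exists_eq_zRotation ((eulerChart (α, β, 0))⁻¹ * g) (by
    change ((eulerChart (α, β, 0) : Matrix (Fin 3) (Fin 3) ℝ).transpose *
      (g : Matrix (Fin 3) (Fin 3) ℝ)) 2 2 = 1
    simp only [Matrix.mul_apply, Matrix.transpose_apply, Fin.sum_univ_three, h]
    exact h2)
  refine ⟨(α, β, γ), ⟨hα, hβ, hγ⟩, ?_⟩
  rw [inv_mul_eq_iff_eq_mul] at hg
  have hz : eulerChart (0, 0, γ) = eulerChart (γ, 0, 0) := by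
    apply Subtype.ext
    ext i j
    fin_cases i <;> fin_cases j <;> simp [eulerChart, eulerMatrix]
  rw [hg, hz, eulerChart_mul_zRotation, zero_add]

/-! ### The chart on the interior of the domain -/

theorem interior_eulerDomain : interior eulerDomain =
    Ioo (-Real.pi) Real.pi ×ˢ Ioo 0 Real.pi ×ˢ Ioo (-Real.pi) Real.pi := by
  simp only [eulerDomain, interior_prod_eq, interior_Icc]

/-- The Euler angles of a rotation whose axis of nodes is defined. -/
noncomputable def eulerAngles (g : SO3) : ℝ × ℝ × ℝ :=
  (Complex.arg ⟨-(g : Matrix (Fin 3) (Fin 3) ℝ) 1 2, (g : Matrix (Fin 3) (Fin 3) ℝ) 0 2⟩,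
    Real.arccos ((g : Matrix (Fin 3) (Fin 3) ℝ) 2 2),
    Complex.arg ⟨(g : Matrix (Fin 3) (Fin 3) ℝ) 2 1, (g : Matrix (Fin 3) (Fin 3) ℝ) 2 0⟩)

/-- The open set of the rotations on which `eulerAngles` is continuous. -/
def eulerTarget : Set SO3 :=
  {g | (⟨-(g : Matrix (Fin 3) (Fin 3) ℝ) 1 2, (g : Matrix (Fin 3) (Fin 3) ℝ) 0 2⟩ : ℂ) ∈
      Complex.slitPlane ∧
    (⟨(g : Matrix (Fin 3) (Fin 3) ℝ) 2 1, (g : Matrix (Fin 3) (Fin 3) ℝ) 2 0⟩ : ℂ) ∈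
      Complex.slitPlane}

theorem continuous_complex_mk {X : Type*} [TopologicalSpace X] {f g : X → ℝ} (hf : Continuous f)
    (hg : Continuous g) : Continuous fun x => (⟨f x, g x⟩ : ℂ) :=
  Complex.equivRealProdCLM.symm.continuous.comp (hf.prodMk hg)

theorem isOpen_eulerTarget : IsOpen eulerTarget :=
  (Complex.isOpen_slitPlane.preimage (continuous_complex_mk (SO3.continuous_entry 1 2).neg
    (SO3.continuous_entry 0 2))).inter (Complex.isOpen_slitPlane.preimage
      (continuous_complex_mk (SO3.continuous_entry 2 1) (SO3.continuous_entry 2 0)))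

theorem continuousOn_eulerAngles : ContinuousOn eulerAngles eulerTarget := by
  intro g hg
  apply ContinuousAt.continuousWithinAt
  refine ContinuousAt.prodMk ?_ (ContinuousAt.prodMk ?_ ?_)
  · exact ContinuousAt.comp (f := fun g : SO3 => (⟨-(g : Matrix (Fin 3) (Fin 3) ℝ) 1 2,
        (g : Matrix (Fin 3) (Fin 3) ℝ) 0 2⟩ : ℂ)) (Complex.continuousAt_arg hg.1)
      (continuous_complex_mk (SO3.continuous_entry 1 2).neg (SO3.continuous_entry 0 2)).continuousAt
  · exact (Real.continuous_arccos.comp (SO3.continuous_entry 2 2)).continuousAt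
  · exact ContinuousAt.comp (f := fun g : SO3 => (⟨(g : Matrix (Fin 3) (Fin 3) ℝ) 2 1,
        (g : Matrix (Fin 3) (Fin 3) ℝ) 2 0⟩ : ℂ)) (Complex.continuousAt_arg hg.2)
      (continuous_complex_mk (SO3.continuous_entry 2 1) (SO3.continuous_entry 2 0)).continuousAt

theorem Complex.mk_mul_cos_sin (r t : ℝ) :
    (⟨r * Real.cos t, r * Real.sin t⟩ : ℂ) = r * (Complex.cos t + Complex.sin t * Complex.I) := by
  apply Complex.ext <;>
    simp [← Complex.ofReal_cos, ← Complex.ofReal_sin]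

/-- The two complex numbers are `sin β · e^{iα}` and `sin β · e^{iγ}`. The slit plane omits 0 and
the negative axis, which excludes exactly `sin β = 0` and outer angles `±π`. -/
theorem eulerChart_mem_eulerTarget_iff {u : ℝ × ℝ × ℝ} (hu : u ∈ eulerDomain) :
    eulerChart u ∈ eulerTarget ↔ u ∈ interior eulerDomain := by
  obtain ⟨α, β, γ⟩ := u
  obtain ⟨⟨ha, ha'⟩, ⟨hb, hb'⟩, ⟨hc, hc'⟩⟩ := hu
  dsimp only at ha ha' hb hb' hc hc'
  have key : ∀ t : ℝ, -Real.pi ≤ t → t ≤ Real.pi → 0 < Real.sin β →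
      (0 < Real.sin β * Real.cos t ∨ Real.sin β * Real.sin t ≠ 0 ↔
        -Real.pi < t ∧ t < Real.pi) := by
    intro t h h' hs
    constructor
    · intro H
      refine ⟨h.lt_of_ne ?_, h'.lt_of_ne ?_⟩
      · rintro rfl
        simp at H
        linarith
      · rintro rfl
        simp at H
        linarith
    · rintro ⟨h, h'⟩
      by_cases h0 : t = 0
      · left
        simpa [h0] using hs
      · right
        exact mul_ne_zero hs.ne' (mt (Real.sin_eq_zero_iff_of_lt_of_lt h h').1 h0)
  have hmem : eulerChart (α, β, γ) ∈ eulerTarget ↔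
      (0 < Real.sin β * Real.cos α ∨ Real.sin β * Real.sin α ≠ 0) ∧
      (0 < Real.sin β * Real.cos γ ∨ Real.sin β * Real.sin γ ≠ 0) := by
    simp [eulerTarget, Complex.mem_slitPlane_iff, eulerChart, eulerMatrix, mul_comm]
  rw [hmem, interior_eulerDomain]
  simp only [mem_prod, mem_Ioo]
  rcases hb.eq_or_lt with rfl | hb0
  · simp
  rcases hb'.eq_or_lt with rfl | hbp
  · simp
  have hs := Real.sin_pos_of_pos_of_lt_pi hb0 hbp
  rw [key α ha ha' hs, key γ hc hc' hs]
  tauto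

theorem eulerAngles_eulerChart {u : ℝ × ℝ × ℝ} (hu : u ∈ interior eulerDomain) :
    eulerAngles (eulerChart u) = u := by
  rw [interior_eulerDomain] at hu
  obtain ⟨α, β, γ⟩ := u
  obtain ⟨⟨ha, ha'⟩, ⟨hb, hb'⟩, ⟨hc, hc'⟩⟩ := hu
  dsimp only at ha ha' hb hb' hc hc'
  have hs := Real.sin_pos_of_pos_of_lt_pi hb hb'
  have key : ∀ t : ℝ, -Real.pi < t → t < Real.pi →
      Complex.arg ⟨Real.sin β * Real.cos t, Real.sin β * Real.sin t⟩ = t := by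
    intro t h h'
    rw [Complex.mk_mul_cos_sin]
    exact Complex.arg_mul_cos_add_sin_mul_I hs ⟨h, h'.le⟩
  refine Prod.ext ?_ (Prod.ext ?_ ?_)
  · simpa [eulerAngles, eulerChart, eulerMatrix, mul_comm] using key α ha ha'
  · simpa [eulerAngles, eulerChart, eulerMatrix] using Real.arccos_cos hb.le hb'.le
  · simpa [eulerAngles, eulerChart, eulerMatrix, mul_comm] using key γ hc hc'

/-- The Euler-angle chart, as a homeomorphism between open sets. -/
noncomputable def eulerOpenPartialHomeomorph : OpenPartialHomeomorph (ℝ × ℝ × ℝ) SO3 where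
  toFun := eulerChart
  invFun := eulerAngles
  source := interior eulerDomain
  target := eulerTarget
  map_source' u hu := (eulerChart_mem_eulerTarget_iff (interior_subset hu)).2 hu
  map_target' g hg := by
    -- Surjectivity from the closed domain gives some preimage, and membership in the target forces
    -- it into the interior.
    obtain ⟨u, hu, rfl⟩ := eulerChart_image_eulerDomain.symm ▸ mem_univ g
    have := (eulerChart_mem_eulerTarget_iff hu).1 hg
    rwa [eulerAngles_eulerChart this]
  left_inv' u hu := eulerAngles_eulerChart hu
  right_inv' g hg := by
    obtain ⟨u, hu, rfl⟩ := eulerChart_image_eulerDomain.symm ▸ mem_univ g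
    rw [eulerAngles_eulerChart ((eulerChart_mem_eulerTarget_iff hu).1 hg)]
  open_source := isOpen_interior
  open_target := isOpen_eulerTarget
  continuousOn_toFun := continuous_eulerChart.continuousOn
  continuousOn_invFun := continuousOn_eulerAngles

theorem isOpenEmbedding_eulerChart :
    Topology.IsOpenEmbedding ((interior eulerDomain).domRestrict eulerChart) :=
  eulerOpenPartialHomeomorph.isOpenEmbedding_restrict

/-! ### The invariant volume form in Euler angles -/

/-- The partial derivatives of the Euler matrix in closed form. -/
noncomputable def eulerPartialExplicit (α β γ : ℝ) : Fin 3 → Matrix (Fin 3) (Fin 3) ℝ :=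
  ![!![-Real.sin α * Real.cos γ - Real.cos β * Real.cos α * Real.sin γ,
      Real.sin α * Real.sin γ - Real.cos β * Real.cos γ * Real.cos α,
      Real.cos α * Real.sin β;
    Real.cos γ * Real.cos α - Real.sin α * Real.cos β * Real.sin γ,
      -Real.sin α * Real.cos β * Real.cos γ - Real.cos α * Real.sin γ,
      Real.sin α * Real.sin β;
    0, 0, 0],
    !![Real.sin β * Real.sin α * Real.sin γ,
      Real.sin β * Real.cos γ * Real.sin α,
      Real.sin α * Real.cos β;
    -Real.cos α * Real.sin β * Real.sin γ,
      -Real.cos α * Real.sin β * Real.cos γ,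
      -Real.cos α * Real.cos β;
    Real.cos β * Real.sin γ, Real.cos γ * Real.cos β, -Real.sin β],
    !![-Real.cos α * Real.sin γ - Real.cos β * Real.sin α * Real.cos γ,
      -Real.cos α * Real.cos γ + Real.cos β * Real.sin γ * Real.sin α,
      0;
    -Real.sin γ * Real.sin α + Real.cos α * Real.cos β * Real.cos γ,
      -Real.cos α * Real.cos β * Real.sin γ - Real.sin α * Real.cos γ,
      0;
    Real.sin β * Real.cos γ, -Real.sin γ * Real.sin β, 0]]

theorem hasLineDerivAt_eulerMatrix (α β γ a b c : ℝ) (i k : Fin 3) :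
    HasLineDerivAt ℝ (fun v => eulerMatrix v i k)
      (a * eulerPartialExplicit α β γ 0 i k + b * eulerPartialExplicit α β γ 1 i k +
        c * eulerPartialExplicit α β γ 2 i k) (α, β, γ) (a, b, c) := by
  have hl : ∀ x d : ℝ, HasDerivAt (fun t => x + t * d) d 0 := fun x d => by
    simpa using ((hasDerivAt_id (0 : ℝ)).mul_const d).const_add x
  have hs : ∀ x d : ℝ, HasDerivAt (fun t => Real.sin (x + t * d)) (Real.cos x * d) 0 :=
    fun x d => by simpa using (hl x d).sin
  have hc : ∀ x d : ℝ, HasDerivAt (fun t => Real.cos (x + t * d)) (-Real.sin x * d) 0 :=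
    fun x d => by simpa using (hl x d).cos
  have sa := hs α a
  have sb := hs β b
  have sc := hs γ c
  have ca := hc α a
  have cb := hc β b
  have cc := hc γ c
  unfold HasLineDerivAt
  fin_cases i <;> fin_cases k
  · refine ((ca.mul cc).sub ((cb.mul sa).mul sc)).congr_deriv ?_
    simp [eulerPartialExplicit]; ring
  · refine ((ca.neg.mul sc).sub ((cb.mul cc).mul sa)).congr_deriv ?_
    simp [eulerPartialExplicit]; ring
  · refine (sa.mul sb).congr_deriv ?_
    simp [eulerPartialExplicit]; ring
  · refine ((cc.mul sa).add ((ca.mul cb).mul sc)).congr_deriv ?_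
    simp [eulerPartialExplicit]; ring
  · refine (((ca.mul cb).mul cc).sub (sa.mul sc)).congr_deriv ?_
    simp [eulerPartialExplicit]; ring
  · refine (ca.neg.mul sb).congr_deriv ?_
    simp [eulerPartialExplicit]; ring
  · refine (sb.mul sc).congr_deriv ?_
    simp [eulerPartialExplicit]; ring
  · refine (cc.mul sb).congr_deriv ?_
    simp [eulerPartialExplicit]; ring
  · refine cb.congr_deriv ?_
    simp [eulerPartialExplicit]; ring

theorem eulerPartial_eq (α β γ : ℝ) (j : Fin 3) :
    eulerPartial j (α, β, γ) = eulerPartialExplicit α β γ j := by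
  ext i k
  fin_cases j
  · exact (hasLineDerivAt_eulerMatrix α β γ 1 0 0 i k).lineDeriv.trans (by simp)
  · exact (hasLineDerivAt_eulerMatrix α β γ 0 1 0 i k).lineDeriv.trans (by simp)
  · exact (hasLineDerivAt_eulerMatrix α β γ 0 0 1 i k).lineDeriv.trans (by simp)

theorem eulerVolumeCoeff_eq (u : ℝ × ℝ × ℝ) : eulerVolumeCoeff u = -Real.sin u.2.1 := by
  obtain ⟨α, β, γ⟩ := u
  have ha := Real.sin_sq_add_cos_sq α
  have hb := Real.sin_sq_add_cos_sq β
  have hc := Real.sin_sq_add_cos_sq γ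
  have hinv : (((eulerChart (α, β, γ))⁻¹ : SO3) : Matrix (Fin 3) (Fin 3) ℝ) =
    (eulerMatrix (α, β, γ)).transpose := rfl
  -- The columns are the angular velocities in the body frame: `e_Z` moved by `p⁻¹`, `e_X` moved by
  -- `R(e_Z, γ)⁻¹`, and `e_Z`.
  have key : (Matrix.of fun i j => maurerCartan (eulerChart (α, β, γ))
      (eulerPartial j (α, β, γ)) i) =
      !![Real.sin β * Real.sin γ, Real.cos γ, 0;
        Real.sin β * Real.cos γ, -Real.sin γ, 0;
        Real.cos β, 0, 1] := by
    ext i j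
    simp only [Matrix.of_apply, maurerCartan, eulerPartial_eq, hinv]
    fin_cases i <;> fin_cases j <;>
      simp [eulerMatrix, eulerPartialExplicit, hat, Matrix.trace, Fin.sum_univ_three,
        Matrix.mul_apply] <;> grind
  rw [eulerVolumeCoeff, key, Matrix.det_fin_three]
  simp
  grind

theorem integral_eulerVolumeCoeff :
    ∫ v in eulerDomain, eulerVolumeCoeff v = -(8 * Real.pi ^ 2) := by
  simp only [eulerVolumeCoeff_eq, integral_neg]
  have h1 := setIntegral_prod_mul (μ := (volume : Measure ℝ)) (ν := (volume : Measure ℝ)) Real.sin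
    (fun _ => (1 : ℝ)) (Icc 0 Real.pi) (Icc (-Real.pi) Real.pi)
  have h2 := setIntegral_prod_mul (μ := (volume : Measure ℝ)) (ν := (volume : Measure (ℝ × ℝ)))
    (fun _ => (1 : ℝ)) (fun z => Real.sin z.1 * 1) (Icc (-Real.pi) Real.pi)
    (Icc 0 Real.pi ×ˢ Icc (-Real.pi) Real.pi)
  have hsin : ∫ x in Icc 0 Real.pi, Real.sin x = 2 := by
    rw [integral_Icc_eq_integral_Ioc, ← intervalIntegral.integral_of_le Real.pi_pos.le,
      integral_sin]
    norm_num
  have hone : ∫ _ in Icc (-Real.pi) Real.pi, (1 : ℝ) = 2 * Real.pi := by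
    simp [Real.pi_pos.le]
    ring
  rw [← Measure.volume_eq_prod, hsin, hone] at h1
  rw [← Measure.volume_eq_prod, h1, hone] at h2
  simp only [one_mul, mul_one] at h2
  rw [eulerDomain, h2]
  ring

/-- The coefficient and its integral are both negative, so the orientation of the coordinates
cancels. -/
theorem normalised_eulerVolumeCoeff (u : ℝ × ℝ × ℝ) :
    (∫ v in eulerDomain, eulerVolumeCoeff v)⁻¹ * eulerVolumeCoeff u =
      1 / (8 * Real.pi ^ 2) * Real.sin u.2.1 := by
  rw [integral_eulerVolumeCoeff, eulerVolumeCoeff_eq, inv_neg, neg_mul_neg, one_div]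

/-! ### Two-sided invariance of the Haar measure, and integrals over a period -/

instance instSecondCountableTopologySO3 : SecondCountableTopology SO3 :=
  haveI : SecondCountableTopology (Matrix (Fin 3) (Fin 3) ℝ) :=
    inferInstanceAs (SecondCountableTopology (Fin 3 → Fin 3 → ℝ))
  Topology.IsInducing.subtypeVal.secondCountableTopology

instance instIsHaarMeasureHaarSO3 : haarSO3.IsHaarMeasure :=
  inferInstanceAs (Measure.haarMeasure ⊤).IsHaarMeasure

instance instIsProbabilityMeasureHaarSO3 : IsProbabilityMeasure haarSO3 :=
  ⟨by simpa [haarSO3] using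
    Measure.haarMeasure_self (K₀ := (⊤ : TopologicalSpace.PositiveCompacts SO3))⟩

/-- A left-invariant Borel probability measure on the compact group `SO(3)` is its Haar measure. -/
theorem haarSO3_eq_of_isMulLeftInvariant (μ : Measure SO3) [IsProbabilityMeasure μ]
    [μ.IsMulLeftInvariant] : haarSO3 = μ :=
  (Measure.haarMeasure_eq_iff _ _).2 (by simp)

/-- A right translate of the Haar measure is again a left-invariant probability measure, so
uniqueness applies. -/
instance instIsMulRightInvariantHaarSO3 : haarSO3.IsMulRightInvariant where
  map_mul_right_eq_self g := by
    have : IsProbabilityMeasure (haarSO3.map (· * g)) :=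
      Measure.isProbabilityMeasure_map (measurable_mul_const g).aemeasurable
    exact (haarSO3_eq_of_isMulLeftInvariant _).symm

theorem lintegral_haarSO3_mul_mul (f : SO3 → ℝ≥0∞) (a b : SO3) :
    ∫⁻ g, f (a * g * b) ∂haarSO3 = ∫⁻ g, f g ∂haarSO3 := by
  rw [lintegral_mul_left_eq_self (μ := haarSO3) (fun g => f (g * b)) a,
    lintegral_mul_right_eq_self (μ := haarSO3) f b]

/-- The integral of a periodic function over a period is invariant under translations. -/
theorem Function.Periodic.setLIntegral_Icc_add_eq {f : ℝ → ℝ≥0∞} {T : ℝ}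
    (hf : Function.Periodic f T) (hT : 0 < T) (s t : ℝ) :
    ∫⁻ x in Icc s (s + T), f (t + x) = ∫⁻ x in Icc s (s + T), f x := by
  have : VAddInvariantMeasure (AddSubgroup.zmultiples T) ℝ volume :=
    ⟨fun c s _ => measure_preimage_add _ _ _⟩
  have h1 : ∫⁻ x in Icc s (s + T), f (t + x) = ∫⁻ x in Icc (t + s) (t + s + T), f x := by
    rw [(measurePreserving_add_left volume t).setLIntegral_comp_emb
      (measurableEmbedding_addLeft t) f (Icc s (s + T)), image_const_add_Icc, add_assoc]
  -- Half-open intervals of length `T` are fundamental domains for `Tℤ`; the endpoints are null.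
  rw [h1, ← restrict_Ioc_eq_restrict_Icc, ← restrict_Ioc_eq_restrict_Icc]
  exact (isAddFundamentalDomain_Ioc hT _).setLIntegral_eq (isAddFundamentalDomain_Ioc hT _) f
    hf.map_vadd_zmultiples

/-! ### Archimedes' theorem: the law of the height of the rotated pole -/

/-- Integration over a rotation-invariant weight in `ℝ³`, in spherical coordinates, of a function
of the colatitude. -/
theorem lintegral_spherical (φ w : ℝ → ℝ≥0∞) (hφ : Measurable φ) (hw : Measurable w) :
    ∫⁻ x : Fin 3 → ℝ, φ (x 2 / √(x 0 ^ 2 + x 1 ^ 2 + x 2 ^ 2)) *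
        w (x 0 ^ 2 + x 1 ^ 2 + x 2 ^ 2) =
      ENNReal.ofReal (2 * Real.pi) * (∫⁻ r in Ioi (0 : ℝ), ENNReal.ofReal (r ^ 2) * w (r ^ 2)) *
        ∫⁻ β in Ioo 0 Real.pi, φ (Real.cos β) * ENNReal.ofReal (Real.sin β) := by
  have e1 := ((volume_preserving_piFinSuccAbove (fun _ : Fin 3 => ℝ) 2).symm).lintegral_comp_emb
    (MeasurableEquiv.measurableEmbedding _)
    (fun x : Fin 3 → ℝ => φ (x 2 / √(x 0 ^ 2 + x 1 ^ 2 + x 2 ^ 2)) *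
        w (x 0 ^ 2 + x 1 ^ 2 + x 2 ^ 2))
  rw [← e1]
  have e2 : ∀ p : ℝ × (Fin 2 → ℝ),
      (MeasurableEquiv.piFinSuccAbove (fun _ : Fin 3 => ℝ) 2).symm p 2 = p.1 ∧
      (MeasurableEquiv.piFinSuccAbove (fun _ : Fin 3 => ℝ) 2).symm p 0 = p.2 0 ∧
      (MeasurableEquiv.piFinSuccAbove (fun _ : Fin 3 => ℝ) 2).symm p 1 = p.2 1 := by
    intro p
    exact ⟨rfl, rfl, rfl⟩
  simp only [e2]
  rw [Measure.volume_eq_prod, lintegral_prod _ (by fun_prop)]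
  -- Polar coordinates in the horizontal plane: nothing depends on the longitude, which contributes
  -- `2π`.
  have e3 : ∀ z : ℝ, ∫⁻ y : Fin 2 → ℝ, φ (z / √(y 0 ^ 2 + y 1 ^ 2 + z ^ 2)) *
        w (y 0 ^ 2 + y 1 ^ 2 + z ^ 2) = ENNReal.ofReal (2 * Real.pi) *
      ∫⁻ r in Ioi (0 : ℝ), ENNReal.ofReal r * (φ (z / √(z ^ 2 + r ^ 2)) * w (z ^ 2 + r ^ 2)) := by
    intro z
    have := (volume_preserving_finTwoArrow ℝ).lintegral_comp_emb
      (MeasurableEquiv.measurableEmbedding _)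
      (fun y : ℝ × ℝ => φ (z / √(y.1 ^ 2 + y.2 ^ 2 + z ^ 2)) * w (y.1 ^ 2 + y.2 ^ 2 + z ^ 2))
    refine this.trans ?_
    rw [← lintegral_comp_polarCoord_symm, polarCoord_target, Measure.volume_eq_prod,
      setLIntegral_prod_symm _ (by simp only [polarCoord_symm_apply]; fun_prop)]
    have h : ∀ r t : ℝ, (r * Real.cos t) ^ 2 + (r * Real.sin t) ^ 2 + z ^ 2 = z ^ 2 + r ^ 2 := by
      intro r t
      have := Real.sin_sq_add_cos_sq t
      linear_combination r ^ 2 * this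
    simp only [polarCoord_symm_apply, h, smul_eq_mul]
    rw [setLIntegral_const, Real.volume_Ioo, mul_comm]
    congr 2
    ring
  refine (lintegral_congr e3).trans ?_
  rw [lintegral_const_mul _ (by fun_prop)]
  -- The half-plane `r > 0` extends to the whole plane at no cost, since `ENNReal.ofReal r` vanishes
  -- for `r ≤ 0`. A second use of polar coordinates, in `(z, r)`, gives the radius and the
  -- colatitude.
  have e4 : ∫⁻ z : ℝ, ∫⁻ r in Ioi (0 : ℝ), ENNReal.ofReal r *
      (φ (z / √(z ^ 2 + r ^ 2)) * w (z ^ 2 + r ^ 2)) =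
      ∫⁻ p : ℝ × ℝ, ENNReal.ofReal p.2 *
        (φ (p.1 / √(p.1 ^ 2 + p.2 ^ 2)) * w (p.1 ^ 2 + p.2 ^ 2)) := by
    rw [Measure.volume_eq_prod, lintegral_prod _ (by fun_prop)]
    refine lintegral_congr fun z => ?_
    rw [← lintegral_indicator measurableSet_Ioi]
    refine lintegral_congr fun r => ?_
    by_cases hr : 0 < r
    · rw [indicator_of_mem (mem_Ioi.2 hr)]
    · rw [indicator_of_notMem (by simpa using hr), ENNReal.ofReal_of_nonpos (not_lt.1 hr), zero_mul]
  rw [e4, ← lintegral_comp_polarCoord_symm, polarCoord_target, Measure.volume_eq_prod,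
      setLIntegral_prod _ (by simp only [polarCoord_symm_apply]; fun_prop), mul_assoc]
  congr 1
  rw [← lintegral_mul_const _ (by fun_prop)]
  refine setLIntegral_congr_fun measurableSet_Ioi fun r (hr : 0 < r) => ?_
  have h : ∀ t : ℝ, (r * Real.cos t) ^ 2 + (r * Real.sin t) ^ 2 = r ^ 2 := by
    intro t
    have := Real.sin_sq_add_cos_sq t
    linear_combination r ^ 2 * this
  simp only [polarCoord_symm_apply, h, smul_eq_mul, Real.sqrt_sq hr.le,
    mul_div_cancel_left₀ _ hr.ne']
  rw [← lintegral_const_mul _ (by fun_prop), ← Ioc_union_Ioo_eq_Ioo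
    (neg_nonpos.2 Real.pi_pos.le) Real.pi_pos, lintegral_union measurableSet_Ioo
    (Set.disjoint_left.2 fun x hx hx' => hx.2.not_gt hx'.1)]
  -- For the same reason the angles with nonpositive sine contribute nothing.
  have hz : ∫⁻ t in Ioc (-Real.pi) 0, ENNReal.ofReal r * (ENNReal.ofReal (r * Real.sin t) *
      (φ (Real.cos t) * w (r ^ 2))) = 0 := by
    rw [setLIntegral_congr_fun (g := fun _ => 0) measurableSet_Ioc, lintegral_zero]
    intro t ht
    have := Real.sin_nonpos_of_nonpos_of_neg_pi_le ht.2 ht.1.le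
    simp [ENNReal.ofReal_of_nonpos (mul_nonpos_of_nonneg_of_nonpos hr.le this)]
  rw [hz, zero_add]
  refine lintegral_congr fun t => ?_
  rw [ENNReal.ofReal_mul hr.le, pow_two, ENNReal.ofReal_mul hr.le]
  ring

theorem SO3.lintegral_mulVec (g : SO3) (F : (Fin 3 → ℝ) → ℝ≥0∞) (hF : Measurable F) :
    ∫⁻ x, F ((g : Matrix (Fin 3) (Fin 3) ℝ).mulVec x) = ∫⁻ x, F x := by
  have h := Real.map_matrix_volume_pi_eq_smul_volume_pi
    (M := (g : Matrix (Fin 3) (Fin 3) ℝ)) (by rw [g.det_eq_one]; exact one_ne_zero)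
  rw [g.det_eq_one] at h
  simp only [inv_one, abs_one, ENNReal.ofReal_one, one_smul] at h
  conv_rhs => rw [← h]
  rw [lintegral_map hF (Matrix.toLin' _).continuous_of_finiteDimensional.measurable]
  rfl

theorem SO3.sum_sq_mulVec (g : SO3) (x : Fin 3 → ℝ) :
    (g : Matrix (Fin 3) (Fin 3) ℝ).mulVec x 0 ^ 2 + (g : Matrix (Fin 3) (Fin 3) ℝ).mulVec x 1 ^ 2 +
      (g : Matrix (Fin 3) (Fin 3) ℝ).mulVec x 2 ^ 2 = x 0 ^ 2 + x 1 ^ 2 + x 2 ^ 2 := by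
  have h := g.transpose_mul
  have c := fun i j => congrFun (congrFun h i) j
  simp only [Matrix.mul_apply, Matrix.transpose_apply, Fin.sum_univ_three] at c
  have c00 := c 0 0
  have c11 := c 1 1
  have c22 := c 2 2
  have c01 := c 0 1
  have c02 := c 0 2
  have c12 := c 1 2
  simp at c00 c11 c22 c01 c02 c12
  simp only [Matrix.mulVec, dotProduct, Fin.sum_univ_three]
  linear_combination x 0 ^ 2 * c00 + x 1 ^ 2 * c11 + x 2 ^ 2 * c22 + 2 * x 0 * x 1 * c01 +
    2 * x 0 * x 2 * c02 + 2 * x 1 * x 2 * c12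

@[fun_prop]
theorem SO3.measurable_entry (i j : Fin 3) :
    Measurable fun g : SO3 => (g : Matrix (Fin 3) (Fin 3) ℝ) i j :=
  (SO3.continuous_entry i j).measurable

/-- The law of the component of the third column of a random rotation along a given direction
does not depend on the direction. -/
theorem lintegral_haarSO3_direction (φ : ℝ → ℝ≥0∞) (x : Fin 3 → ℝ) (hx : x ≠ 0) :
    ∫⁻ g : SO3, φ ((x 0 * (g : Matrix (Fin 3) (Fin 3) ℝ) 0 2 +
        x 1 * (g : Matrix (Fin 3) (Fin 3) ℝ) 1 2 + x 2 * (g : Matrix (Fin 3) (Fin 3) ℝ) 2 2) /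
          √(x 0 ^ 2 + x 1 ^ 2 + x 2 ^ 2)) ∂haarSO3 =
      ∫⁻ g : SO3, φ ((g : Matrix (Fin 3) (Fin 3) ℝ) 2 2) ∂haarSO3 := by
  have hpos : 0 < x 0 ^ 2 + x 1 ^ 2 + x 2 ^ 2 := by
    by_contra hn
    apply hx
    ext i
    have h0 := sq_nonneg (x 0)
    have h1 := sq_nonneg (x 1)
    have h2 := sq_nonneg (x 2)
    fin_cases i <;> exact pow_eq_zero_iff two_ne_zero |>.1 (by
      simp only [Fin.zero_eta, Fin.mk_one, Fin.reduceFinMk]; linarith)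
  set r := √(x 0 ^ 2 + x 1 ^ 2 + x 2 ^ 2) with hr
  have hr0 : 0 < r := Real.sqrt_pos.2 hpos
  have hr2 : r ^ 2 = x 0 ^ 2 + x 1 ^ 2 + x 2 ^ 2 := Real.sq_sqrt hpos.le
  obtain ⟨α, -, β, -, h⟩ := exists_eulerChart_column (fun i => x i / r) (by
    simp only [div_pow, ← add_div, ← hr2]
    exact div_self (pow_ne_zero 2 hr0.ne'))
  -- If `h` has third column `x/r`, the entry `(2, 2)` of `h⁻¹ g` is the scalar product of `x/r`
  -- with the third column of `g`.
  rw [← lintegral_mul_left_eq_self (μ := haarSO3)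
    (fun g => φ ((g : Matrix (Fin 3) (Fin 3) ℝ) 2 2)) (eulerChart (α, β, 0))⁻¹]
  refine lintegral_congr fun g => congrArg φ ?_
  change _ = ((eulerChart (α, β, 0) : Matrix (Fin 3) (Fin 3) ℝ).transpose *
    (g : Matrix (Fin 3) (Fin 3) ℝ)) 2 2
  simp only [Matrix.mul_apply, Matrix.transpose_apply, Fin.sum_univ_three, h]
  ring

theorem lintegral_sin_Ioo : ∫⁻ β in Ioo 0 Real.pi, ENNReal.ofReal (Real.sin β) = 2 := by
  rw [restrict_Ioo_eq_restrict_Ioc, ← ofReal_integral_eq_lintegral_ofReal,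
    ← intervalIntegral.integral_of_le Real.pi_pos.le, integral_sin]
  · norm_num
  · exact (Real.continuous_sin.integrableOn_Icc).mono_set Ioc_subset_Icc_self
  · refine (ae_restrict_iff' measurableSet_Ioc).2 (.of_forall fun x hx => ?_)
    exact Real.sin_nonneg_of_nonneg_of_le_pi hx.1.le hx.2

theorem lintegral_radial_indicator :
    ∫⁻ r in Ioi (0 : ℝ), ENNReal.ofReal (r ^ 2) * (Iic (1 : ℝ)).indicator 1 (r ^ 2) =
      ENNReal.ofReal (1 / 3) := by
  have h : ∀ r ∈ Ioi (0 : ℝ), ENNReal.ofReal (r ^ 2) * (Iic (1 : ℝ)).indicator 1 (r ^ 2) =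
      (Iic (1 : ℝ)).indicator (fun r => ENNReal.ofReal (r ^ 2)) r := by
    intro r hr
    have : r ^ 2 ≤ 1 ↔ r ≤ 1 := by
      rw [sq_le_one_iff_abs_le_one, abs_of_pos hr]
    by_cases h1 : r ≤ 1 <;> simp [indicator, this, h1]
  rw [setLIntegral_congr_fun measurableSet_Ioi h, lintegral_indicator measurableSet_Iic,
    Measure.restrict_restrict measurableSet_Iic, Iic_inter_Ioi,
    ← ofReal_integral_eq_lintegral_ofReal, ← intervalIntegral.integral_of_le zero_le_one,
    integral_pow]
  · norm_num
  · exact ((continuous_pow 2).integrableOn_Icc).mono_set Ioc_subset_Icc_self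
  · exact .of_forall fun x => sq_nonneg x

/-- Archimedes' theorem for a random rotation: the height of the image of the pole is uniformly
distributed. -/
theorem lintegral_haarSO3_height (φ : ℝ → ℝ≥0∞) (hφ : Measurable φ) :
    2 * ∫⁻ g : SO3, φ ((g : Matrix (Fin 3) (Fin 3) ℝ) 2 2) ∂haarSO3 =
      ∫⁻ β in Ioo 0 Real.pi, φ (Real.cos β) * ENNReal.ofReal (Real.sin β) := by
  -- Evaluated at `|x|²`, this weight selects the unit ball. The constant `K` cancels at the end, so
  -- it only has to be nonzero and finite.
  set w : ℝ → ℝ≥0∞ := (Iic (1 : ℝ)).indicator 1 with hwdef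
  have hw : Measurable w := measurable_one.indicator measurableSet_Iic
  set K := ENNReal.ofReal (2 * Real.pi) *
    (∫⁻ r in Ioi (0 : ℝ), ENNReal.ofReal (r ^ 2) * w (r ^ 2)) with hKdef
  have hK : K = ENNReal.ofReal (2 * Real.pi * (1 / 3)) := by
    rw [hKdef, lintegral_radial_indicator, ← ENNReal.ofReal_mul (by positivity)]
  have hK0 : K ≠ 0 := by
    rw [hK]
    simp only [ne_eq, ENNReal.ofReal_eq_zero, not_le]
    positivity
  have hKtop : K ≠ ∞ := hK ▸ ENNReal.ofReal_ne_top
  set I := ∫⁻ g : SO3, φ ((g : Matrix (Fin 3) (Fin 3) ℝ) 2 2) ∂haarSO3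
  have hone := lintegral_spherical 1 w measurable_one hw
  simp only [Pi.one_apply, one_mul, lintegral_sin_Ioo] at hone
  have hmain := lintegral_spherical φ w hφ hw
  have key : ∫⁻ x : Fin 3 → ℝ, w (x 0 ^ 2 + x 1 ^ 2 + x 2 ^ 2) * I =
      ∫⁻ x : Fin 3 → ℝ, φ (x 2 / √(x 0 ^ 2 + x 1 ^ 2 + x 2 ^ 2)) *
        w (x 0 ^ 2 + x 1 ^ 2 + x 2 ^ 2) := by
    calc
      _ = ∫⁻ x : Fin 3 → ℝ, (∫⁻ g : SO3, φ ((x 0 * (g : Matrix (Fin 3) (Fin 3) ℝ) 0 2 +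
            x 1 * (g : Matrix (Fin 3) (Fin 3) ℝ) 1 2 +
            x 2 * (g : Matrix (Fin 3) (Fin 3) ℝ) 2 2) / √(x 0 ^ 2 + x 1 ^ 2 + x 2 ^ 2)) *
          w (x 0 ^ 2 + x 1 ^ 2 + x 2 ^ 2) ∂haarSO3) := by
        refine lintegral_congr_ae ?_
        filter_upwards [Measure.ae_ne volume (0 : Fin 3 → ℝ)] with x hx
        rw [lintegral_mul_const _ (by fun_prop), lintegral_haarSO3_direction φ x hx, mul_comm]
      _ = ∫⁻ g : SO3, (∫⁻ x : Fin 3 → ℝ, φ ((x 0 * (g : Matrix (Fin 3) (Fin 3) ℝ) 0 2 +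
            x 1 * (g : Matrix (Fin 3) (Fin 3) ℝ) 1 2 +
            x 2 * (g : Matrix (Fin 3) (Fin 3) ℝ) 2 2) / √(x 0 ^ 2 + x 1 ^ 2 + x 2 ^ 2)) *
          w (x 0 ^ 2 + x 1 ^ 2 + x 2 ^ 2)) ∂haarSO3 := by
        have hx (i : Fin 3) : Measurable fun p : (Fin 3 → ℝ) × SO3 => p.1 i :=
          (measurable_pi_apply i).comp measurable_fst
        have hg (i : Fin 3) : Measurable fun p : (Fin 3 → ℝ) × SO3 =>
            (p.2 : Matrix (Fin 3) (Fin 3) ℝ) i 2 := (SO3.measurable_entry i 2).comp measurable_snd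
        have hn : Measurable fun p : (Fin 3 → ℝ) × SO3 => p.1 0 ^ 2 + p.1 1 ^ 2 + p.1 2 ^ 2 :=
          (((hx 0).pow_const 2).add ((hx 1).pow_const 2)).add ((hx 2).pow_const 2)
        have hi := (((hx 0).mul (hg 0)).add ((hx 1).mul (hg 1))).add ((hx 2).mul (hg 2))
        exact lintegral_lintegral_swap
          ((hφ.comp (hi.div hn.sqrt)).mul (hw.comp hn)).aemeasurable
      _ = ∫⁻ g : SO3, (∫⁻ x : Fin 3 → ℝ, φ (x 2 / √(x 0 ^ 2 + x 1 ^ 2 + x 2 ^ 2)) *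
            w (x 0 ^ 2 + x 1 ^ 2 + x 2 ^ 2)) ∂haarSO3 := by
        refine lintegral_congr fun g => ?_
        -- Substituting `g⁻¹x` for `x` preserves volume and norm, and the last coordinate of `g⁻¹x`
        -- is the scalar product of `x` with the third column of `g`.
        rw [← SO3.lintegral_mulVec g⁻¹ (fun x => φ (x 2 / √(x 0 ^ 2 + x 1 ^ 2 + x 2 ^ 2)) *
          w (x 0 ^ 2 + x 1 ^ 2 + x 2 ^ 2)) (by fun_prop)]
        refine lintegral_congr fun x => ?_
        simp only [SO3.sum_sq_mulVec]
        refine congrArg (fun t => φ (t / _) * _) ?_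
        change _ = (g : Matrix (Fin 3) (Fin 3) ℝ).transpose.mulVec x 2
        simp only [Matrix.mulVec, dotProduct, Fin.sum_univ_three, Matrix.transpose_apply]
        ring
      _ = _ := by simp
  rw [lintegral_mul_const _ (by fun_prop), hone, hmain, mul_assoc] at key
  exact (ENNReal.mul_right_inj hK0 hKtop).1 key

/-! ### Averaging over double cosets and the Haar integral in Euler angles -/

theorem measurable_eulerChart : Measurable eulerChart := continuous_eulerChart.measurable

theorem periodic_eulerChart_fst (β γ : ℝ) :
    Function.Periodic (fun α => eulerChart (α, β, γ)) (2 * Real.pi) := fun α =>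
  Subtype.ext (by simp [eulerChart, eulerMatrix])

theorem periodic_eulerChart_trd (α β : ℝ) :
    Function.Periodic (fun γ => eulerChart (α, β, γ)) (2 * Real.pi) := fun γ =>
  Subtype.ext (by simp [eulerChart, eulerMatrix])

/-- The average of a function over the double coset of a rotation depends on its second Euler angle
only. -/
theorem lintegral_zRotation_mul_mul (f : SO3 → ℝ≥0∞) (g : SO3) :
    ∫⁻ a in Icc (-Real.pi) Real.pi, ∫⁻ c in Icc (-Real.pi) Real.pi,
        f (eulerChart (a, 0, 0) * g * eulerChart (c, 0, 0)) =
      ∫⁻ a in Icc (-Real.pi) Real.pi, ∫⁻ c in Icc (-Real.pi) Real.pi,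
        f (eulerChart (a, Real.arccos ((g : Matrix (Fin 3) (Fin 3) ℝ) 2 2), c)) := by
  obtain ⟨⟨α, β, γ⟩, ⟨-, hβ, -⟩, rfl⟩ := eulerChart_image_eulerDomain.symm ▸ mem_univ g
  have hb : Real.arccos ((eulerChart (α, β, γ) : Matrix (Fin 3) (Fin 3) ℝ) 2 2) = β := by
    simpa [eulerChart, eulerMatrix] using Real.arccos_cos hβ.1 hβ.2
  have hpi : Real.pi = -Real.pi + 2 * Real.pi := by ring
  rw [hb]
  simp only [zRotation_mul_eulerChart, eulerChart_mul_zRotation]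
  have h1 : ∀ a, ∫⁻ c in Icc (-Real.pi) Real.pi, f (eulerChart (a, β, γ + c)) =
      ∫⁻ c in Icc (-Real.pi) Real.pi, f (eulerChart (a, β, c)) := fun a => by
    have := ((periodic_eulerChart_trd a β).comp f).setLIntegral_Icc_add_eq
      Real.two_pi_pos (-Real.pi) γ
    rwa [← hpi] at this
  simp only [h1]
  have h2 : Function.Periodic (fun a => ∫⁻ c in Icc (-Real.pi) Real.pi, f (eulerChart (a, β, c)))
      (2 * Real.pi) := fun a => lintegral_congr fun c =>
    congrArg f (periodic_eulerChart_fst β c a)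
  have := h2.setLIntegral_Icc_add_eq Real.two_pi_pos (-Real.pi) α
  rw [← hpi] at this
  simpa only [add_comm] using this

theorem lintegral_haarSO3_eq (f : SO3 → ℝ≥0∞) (hf : Measurable f) :
    ∫⁻ g, f g ∂haarSO3 = ∫⁻ u in eulerDomain,
      ENNReal.ofReal (1 / (8 * Real.pi ^ 2) * Real.sin u.2.1) * f (eulerChart u) := by
  have hp := measurable_eulerChart
  set F : ℝ → ℝ≥0∞ := fun β => ∫⁻ a in Icc (-Real.pi) Real.pi, ∫⁻ c in Icc (-Real.pi) Real.pi,
    f (eulerChart (a, β, c)) with hF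
  have hFm : Measurable F := by
    refine Measurable.lintegral_prod_right' (f := fun q : ℝ × ℝ =>
      ∫⁻ c in Icc (-Real.pi) Real.pi, f (eulerChart (q.2, q.1, c))) ?_
    exact Measurable.lintegral_prod_right' (f := fun q : (ℝ × ℝ) × ℝ =>
      f (eulerChart (q.1.2, q.1.1, q.2))) (by fun_prop)
  have hI : volume (Icc (-Real.pi) Real.pi) = ENNReal.ofReal (2 * Real.pi) := by
    rw [Real.volume_Icc]
    congr 1
    ring
  have havg : ENNReal.ofReal (2 * Real.pi) * (ENNReal.ofReal (2 * Real.pi) *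
      ∫⁻ g, f g ∂haarSO3) =
      ∫⁻ g : SO3, F (Real.arccos ((g : Matrix (Fin 3) (Fin 3) ℝ) 2 2)) ∂haarSO3 := by
    calc
      _ = ∫⁻ a in Icc (-Real.pi) Real.pi, ∫⁻ c in Icc (-Real.pi) Real.pi,
          ∫⁻ g, f (eulerChart (a, 0, 0) * g * eulerChart (c, 0, 0)) ∂haarSO3 := by
        simp only [lintegral_haarSO3_mul_mul, setLIntegral_const, hI]
        ring
      _ = ∫⁻ a in Icc (-Real.pi) Real.pi, ∫⁻ g, (∫⁻ c in Icc (-Real.pi) Real.pi,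
          f (eulerChart (a, 0, 0) * g * eulerChart (c, 0, 0))) ∂haarSO3 := by
        refine lintegral_congr fun a => lintegral_lintegral_swap (Measurable.aemeasurable ?_)
        simp only [Function.uncurry_def]
        fun_prop
      _ = ∫⁻ g, (∫⁻ a in Icc (-Real.pi) Real.pi, ∫⁻ c in Icc (-Real.pi) Real.pi,
          f (eulerChart (a, 0, 0) * g * eulerChart (c, 0, 0))) ∂haarSO3 := by
        refine lintegral_lintegral_swap (Measurable.aemeasurable ?_)
        exact Measurable.lintegral_prod_right' (f := fun q : (ℝ × SO3) × ℝ =>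
          f (eulerChart (q.1.1, 0, 0) * q.1.2 * eulerChart (q.2, 0, 0))) (by fun_prop)
      _ = _ := lintegral_congr fun g => lintegral_zRotation_mul_mul f g
  -- After averaging, the integrand depends on `g₂₂` only, so the law of the height applies.
  have harch := lintegral_haarSO3_height (fun t => F (Real.arccos t))
    (hFm.comp Real.measurable_arccos)
  rw [← havg] at harch
  have hcoord : ∫⁻ u in eulerDomain,
      ENNReal.ofReal (1 / (8 * Real.pi ^ 2) * Real.sin u.2.1) * f (eulerChart u) =
      ENNReal.ofReal (1 / (8 * Real.pi ^ 2)) *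
        ∫⁻ β in Ioo 0 Real.pi, F (Real.arccos (Real.cos β)) * ENNReal.ofReal (Real.sin β) := by
    have hk : 0 ≤ 1 / (8 * Real.pi ^ 2) := by positivity
    simp only [ENNReal.ofReal_mul hk, mul_assoc]
    rw [lintegral_const_mul _ (by fun_prop), eulerDomain, Measure.volume_eq_prod,
      setLIntegral_prod _ (by fun_prop)]
    congr 1
    calc
      _ = ∫⁻ a in Icc (-Real.pi) Real.pi, ∫⁻ β in Icc 0 Real.pi,
          ENNReal.ofReal (Real.sin β) * ∫⁻ c in Icc (-Real.pi) Real.pi,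
            f (eulerChart (a, β, c)) := by
        refine lintegral_congr fun a => ?_
        rw [Measure.volume_eq_prod, setLIntegral_prod _ (by fun_prop)]
        refine lintegral_congr fun β => ?_
        simp only
        rw [lintegral_const_mul _ (by fun_prop)]
      _ = ∫⁻ β in Icc 0 Real.pi, ∫⁻ a in Icc (-Real.pi) Real.pi,
          ENNReal.ofReal (Real.sin β) * ∫⁻ c in Icc (-Real.pi) Real.pi,
            f (eulerChart (a, β, c)) := by
        refine lintegral_lintegral_swap (Measurable.aemeasurable ?_)
        simp only [Function.uncurry_def]
        refine Measurable.mul (by fun_prop) ?_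
        exact Measurable.lintegral_prod_right' (f := fun q : (ℝ × ℝ) × ℝ =>
          f (eulerChart (q.1.1, q.1.2, q.2))) (by fun_prop)
      _ = ∫⁻ β in Ioo 0 Real.pi, ∫⁻ a in Icc (-Real.pi) Real.pi,
          ENNReal.ofReal (Real.sin β) * ∫⁻ c in Icc (-Real.pi) Real.pi,
            f (eulerChart (a, β, c)) := by
        rw [restrict_Ioo_eq_restrict_Icc]
      _ = _ := by
        refine setLIntegral_congr_fun measurableSet_Ioo fun β hβ => ?_
        simp only [Real.arccos_cos hβ.1.le hβ.2.le]
        rw [lintegral_const_mul, mul_comm]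
        exact Measurable.lintegral_prod_right' (f := fun q : ℝ × ℝ =>
          f (eulerChart (q.1, β, q.2))) (by fun_prop)
  rw [hcoord, ← harch]
  have h2 : (2 : ℝ≥0∞) = ENNReal.ofReal 2 := by simp
  simp only [h2, ← mul_assoc]
  rw [← ENNReal.ofReal_mul (by positivity), ← ENNReal.ofReal_mul (by positivity),
    ← ENNReal.ofReal_mul (by positivity)]
  have : 1 / (8 * Real.pi ^ 2) * 2 * (2 * Real.pi) * (2 * Real.pi) = 1 := by
    have := Real.pi_ne_zero
    field_simp
    norm_num
  rw [this, ENNReal.ofReal_one, one_mul]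

theorem haarSO3_eq_map_eulerChart :
    haarSO3 = Measure.map eulerChart ((volume.restrict eulerDomain).withDensity
      fun u => ENNReal.ofReal (1 / (8 * Real.pi ^ 2) * Real.sin u.2.1)) := by
  refine Measure.ext_of_lintegral _ fun f hf => ?_
  rw [lintegral_haarSO3_eq f hf, lintegral_map hf measurable_eulerChart]
  exact (lintegral_withDensity_eq_lintegral_mul _ (by fun_prop)
    (hf.comp measurable_eulerChart)).symm

theorem haarSO3_apply (B : Set SO3) (hB : MeasurableSet B) :
    haarSO3 B = ∫⁻ u in eulerChart ⁻¹' B ∩ eulerDomain,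
      ENNReal.ofReal (1 / (8 * Real.pi ^ 2) * Real.sin u.2.1) := by
  have hm := measurable_eulerChart hB
  rw [haarSO3_eq_map_eulerChart, Measure.map_apply measurable_eulerChart hB,
    withDensity_apply _ hm, Measure.restrict_restrict hm]

/-! ### Measure of the image of a Borel set -/

/-- The domain is convex, and the frontier of a convex set is null. -/
theorem volume_eulerDomain_diff_interior : volume (eulerDomain \ interior eulerDomain) = 0 := by
  have hc : Convex ℝ eulerDomain := (convex_Icc _ _).prod ((convex_Icc _ _).prod (convex_Icc _ _))
  have : (volume : Measure (ℝ × ℝ)).IsAddHaarMeasure := Measure.prod.instIsAddHaarMeasure _ _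
  have : (volume : Measure (ℝ × ℝ × ℝ)).IsAddHaarMeasure := Measure.prod.instIsAddHaarMeasure _ _
  exact measure_mono_null (sdiff_subset_sdiff_left subset_closure) (hc.addHaar_frontier volume)

/-- The interior of the domain does not meet the other fibres of the Euler-angle chart. -/
theorem eq_of_eulerChart_eq {u v : ℝ × ℝ × ℝ} (hu : u ∈ interior eulerDomain)
    (hv : v ∈ eulerDomain) (h : eulerChart v = eulerChart u) : v = u := by
  have hv' : v ∈ interior eulerDomain := by
    rw [← eulerChart_mem_eulerTarget_iff hv, h]
    exact (eulerChart_mem_eulerTarget_iff (interior_subset hu)).2 hu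
  rw [← eulerAngles_eulerChart hu, ← eulerAngles_eulerChart hv', h]

theorem haarSO3_eulerChart_image (A : Set (ℝ × ℝ × ℝ)) (hA : MeasurableSet A)
    (hAU : A ⊆ eulerDomain) : haarSO3 (eulerChart '' A) =
      ∫⁻ u in A, ENNReal.ofReal (1 / (8 * Real.pi ^ 2) * Real.sin u.2.1) := by
  have hcompact : IsCompact eulerDomain := isCompact_Icc.prod (isCompact_Icc.prod isCompact_Icc)
  have hint : MeasurableSet (eulerChart '' (A ∩ interior eulerDomain)) := by
    have := isOpenEmbedding_eulerChart.measurableEmbedding.measurableSet_image.2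
      (hA.preimage (measurable_subtype_coe (p := (· ∈ interior eulerDomain))))
    convert this using 1
    rw [domRestrict_eq, image_comp, Subtype.image_preimage_coe, inter_comm]
  have hbdry : haarSO3 (eulerChart '' (eulerDomain \ interior eulerDomain)) = 0 := by
    have hcl : IsClosed (eulerChart '' (eulerDomain \ interior eulerDomain)) :=
      ((hcompact.diff isOpen_interior).image continuous_eulerChart).isClosed
    rw [haarSO3_apply _ hcl.measurableSet]
    -- Within the domain, the preimage of the image of the boundary is contained in the boundary,
    -- because interior points are alone in their fibres.
    refine setLIntegral_measure_zero _ _ (measure_mono_null ?_ volume_eulerDomain_diff_interior)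
    rintro u ⟨⟨v, hv, hvu⟩, hu⟩
    refine ⟨hu, fun hui => hv.2 ?_⟩
    rwa [eq_of_eulerChart_eq hui hv.1 hvu]
  have hsub : eulerChart '' A ⊆ eulerChart '' (A ∩ interior eulerDomain) ∪
      eulerChart '' (eulerDomain \ interior eulerDomain) := by
    rw [← image_union]
    refine image_mono fun u hu => ?_
    by_cases h : u ∈ interior eulerDomain
    · exact Or.inl ⟨hu, h⟩
    · exact Or.inr ⟨hAU hu, h⟩
  -- Monotonicity and subadditivity suffice here, so `p(A)` itself need not be shown to be Borel.
  have h1 : haarSO3 (eulerChart '' A) = haarSO3 (eulerChart '' (A ∩ interior eulerDomain)) := by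
    refine le_antisymm ?_ (measure_mono (image_mono inter_subset_left))
    refine (measure_mono hsub).trans ((measure_union_le _ _).trans ?_)
    rw [hbdry, add_zero]
  have h2 : eulerChart ⁻¹' (eulerChart '' (A ∩ interior eulerDomain)) ∩ eulerDomain =
      A ∩ interior eulerDomain := by
    ext u
    constructor
    · rintro ⟨⟨v, hv, hvu⟩, hu⟩
      rwa [eq_of_eulerChart_eq hv.2 hu hvu.symm]
    · exact fun hu => ⟨mem_image_of_mem _ hu, hAU hu.1⟩
  have h3 : (A ∩ interior eulerDomain : Set (ℝ × ℝ × ℝ)) =ᵐ[volume] A := by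
    refine ae_eq_set.2 ⟨?_, ?_⟩
    · simp [sdiff_eq_empty.2 (inter_subset_left : A ∩ interior eulerDomain ⊆ A)]
    · exact measure_mono_null (t := eulerDomain \ interior eulerDomain)
        (fun u hu => ⟨hAU hu.1, fun h => hu.2 ⟨hu.1, h⟩⟩) volume_eulerDomain_diff_interior
  rw [h1, haarSO3_apply _ hint, h2, setLIntegral_congr h3]

theorem mainTheorem3 :
    -- the chart is the composition of the `Z`-, `X`- and `Z`-rotations
    (∀ α β γ : ℝ, (eulerChart (α, β, γ) : Matrix (Fin 3) (Fin 3) ℝ) =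
      axisRotation ![0, 0, 1] α * axisRotation ![1, 0, 0] β * axisRotation ![0, 0, 1] γ) ∧
    -- it covers the group, and it is one-to-one and a homeomorphism onto an open set on the interior
    eulerChart '' eulerDomain = univ ∧
    Topology.IsOpenEmbedding ((interior eulerDomain).domRestrict eulerChart) ∧
    -- the Haar measure in the chart, as a pullback: the mass of the image of each Borel set
    (∀ A : Set (ℝ × ℝ × ℝ), MeasurableSet A → A ⊆ eulerDomain →
      haarSO3 (eulerChart '' A) =
        ∫⁻ u in A, ENNReal.ofReal (1 / (8 * Real.pi ^ 2) * Real.sin u.2.1)) ∧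
    -- the Haar measure as the image of the density on the domain of the angles
    haarSO3 = Measure.map eulerChart
      ((volume.restrict eulerDomain).withDensity
        fun u => ENNReal.ofReal (1 / (8 * Real.pi ^ 2) * Real.sin u.2.1)) ∧
    -- the pullback of the invariant volume form, normalised to total mass one
    (∀ u ∈ eulerDomain,
      (∫ v in eulerDomain, eulerVolumeCoeff v)⁻¹ * eulerVolumeCoeff u =
        1 / (8 * Real.pi ^ 2) * Real.sin u.2.1) :=
  ⟨eulerChart_apply_eq_axisRotation, eulerChart_image_eulerDomain, isOpenEmbedding_eulerChart,
    haarSO3_eulerChart_image, haarSO3_eq_map_eulerChart,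
    fun u _ => normalised_eulerVolumeCoeff u⟩
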